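/- Let $d\ge 1$ and let $U\colon\mathbb{R}^d\to\mathbb{R}$ be of class $C^3$ with finitely many critical points, all non-degenerate (that is, $\det\nabla^2U(x)\neq0$ whenever $\nabla U(x)=0$), such that, as $|x|\to\infty$, $$\frac{U(x)}{|x|}\to\infty,\qquad \frac{x}{|x|}\cdot\nabla U(x)\to\infty,\qquad |\nabla U(x)|-2\,\Delta U(x)\to\infty .$$ Let $\mathcal{M}_0$ be the set of local minima of $U$, and assume that it has at least two elements. For $m',m''\in\mathcal{M}_0$, $m'\neq m''$, let $$\Theta(m',m'')=\inf_{z}\max_{t\in[0,1]}U(z(t)),$$ where the infimum is over all continuous $z\colon[0,1]\to\mathbb{R}^d$ with $z(0)=m'$ and $z(1)=m''$, and for $m\in\mathcal{M}_0$ let $$\Gamma(m)=\min_{m'\in\mathcal{M}_0,\,m'\neq m}\Theta(m,m')-U(m).$$ Fix $m\in\mathcal{M}_0$. Then there exist $m'\in\mathcal{M}_0$, $m'\neq m$, and a continuous path $z\colon[0,1]\to\mathbb{R}^d$ with $z(0)=m$, $z(1)=m'$ such that $$\max_{t\in[0,1]}U(z(t))=U(z(1/2))=U(m)+\Gamma(m)=\Theta(m,m'),\qquad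 U(z(s))<U(z(1/2))\ \text{ for all } s\in[0,1]\setminus\{1/2\}.$$ Moreover, for every $m'\in\mathcal{M}_0$, $m'\neq m$, and every such path $z$ from $m$ to $m'$, the point $z(1/2)$ is a saddle point of $U$ of index one: $\nabla U(z(1/2))=0$, and $\nabla^2U(z(1/2))$ has exactly one negative eigenvalue (counted with multiplicity), all the others being strictly positive. -/

import Mathlib

open Filter Topology

namespace MorsePotential

variable {d : ℕ}

/-- The Hessian matrix `∇²U(x)`, with entries `∂ᵢ∂ⱼU(x)`. -/
noncomputable def hessian (U : EuclideanSpace ℝ (Fin d) → ℝ) (x : EuclideanSpace ℝ (Fin d)) :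
    Matrix (Fin d) (Fin d) ℝ :=
  Matrix.of fun i j =>
    fderiv ℝ (fderiv ℝ U) x (EuclideanSpace.single i 1) (EuclideanSpace.single j 1)

/-- The standing assumptions on the potential: `U ∈ C³(ℝᵈ)` has finitely many critical points,
all of them non-degenerate, and satisfies the three growth conditions at infinity. -/
structure IsAdmissible (U : EuclideanSpace ℝ (Fin d) → ℝ) : Prop where
  contDiff : ContDiff ℝ 3 U
  finite_critical : {x | gradient U x = 0}.Finite
  nondegenerate : ∀ x, gradient U x = 0 → (hessian U x).det ≠ 0
  /-- `U(x) / |x| → ∞` as `|x| → ∞` -/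
  superlinear : Tendsto (fun x => U x / ‖x‖) (Bornology.cobounded _) atTop
  /-- `(x / |x|) · ∇U(x) → ∞` as `|x| → ∞` -/
  radial_gradient :
    Tendsto (fun x => inner ℝ (‖x‖⁻¹ • x) (gradient U x)) (Bornology.cobounded _) atTop
  /-- `|∇U(x)| - 2 ΔU(x) → ∞` as `|x| → ∞` -/
  gradient_laplacian :
    Tendsto (fun x => ‖gradient U x‖ - 2 * Laplacian.laplacian U x) (Bornology.cobounded _) atTop

/-- The communication height `Θ(x, y)`: the infimum over all continuous paths from `x` to `y`
of the maximum of `U` along the path. -/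
noncomputable def commHeight (U : EuclideanSpace ℝ (Fin d) → ℝ)
    (x y : EuclideanSpace ℝ (Fin d)) : ℝ :=
  ⨅ z : Path x y, ⨆ t : unitInterval, U (z t)

/-- The depth `Γ(m)`: the minimum of `Θ(m, m')` over the local minima `m' ≠ m`, minus `U(m)`. -/
noncomputable def depth (U : EuclideanSpace ℝ (Fin d) → ℝ) (m : EuclideanSpace ℝ (Fin d)) : ℝ :=
  sInf (commHeight U m '' {m' | IsLocalMin U m' ∧ m' ≠ m}) - U m

/-- The midpoint `1/2` of `[0,1]`. -/
noncomputable def half : unitInterval := ⟨1 / 2, by norm_num, by norm_num⟩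

/-- The path `z` from `m` to `m'` satisfies
`max U(z(t)) = U(z(1/2)) = U(m) + Γ(m) = Θ(m, m')`
and `U(z(s)) < U(z(1/2))` for all `s ≠ 1/2`. -/
structure IsOptimalPath (U : EuclideanSpace ℝ (Fin d) → ℝ) {m m' : EuclideanSpace ℝ (Fin d)}
    (z : Path m m') : Prop where
  max_eq : IsGreatest (Set.range fun t => U (z t)) (U (z half))
  eq_depth : U (z half) = U m + depth U m
  eq_commHeight : U m + depth U m = commHeight U m m'
  lt_of_ne : ∀ s, s ≠ half → U (z s) < U (z half)

/-- `σ` is a saddle point of `U`: a critical point at which the (symmetric) Hessian has exactly one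
negative eigenvalue, counted with multiplicity, all the others being strictly positive. -/
def IsSaddlePoint (U : EuclideanSpace ℝ (Fin d) → ℝ) (σ : EuclideanSpace ℝ (Fin d)) : Prop :=
  gradient U σ = 0 ∧
    ∃ hH : (hessian U σ).IsHermitian,
      ∃ i, hH.eigenvalues i < 0 ∧ ∀ j, j ≠ i → 0 < hH.eigenvalues j

end MorsePotential

/-!
Let `c` be the optimal height `U m + depth U m`. Every `{U < e}` with `e > c` joins `m` to another
minimum while `{U < c}` does not, so by compactness the component of `m` in `{U < c}` and the rest
of `{U < c}` have a common closure point `σ`, and `U σ = c`. At such a point `{U < c}` is not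
locally path connected, and neither is it at the top of an optimal path, since a detour below the
top would lower the communication height.

This failure detects index-one saddles. At a noncritical point the implicit function theorem
straightens the sublevel set to a half-space. At a nondegenerate critical point `U` is, near `σ`,
strictly concave on the slice through `σ` along the negative space `S` of the Hessian and strictly
convex along `Sᗮ`, so a point of `{U < U σ}` can be moved inside this set to its projection on
`σ + S`, where the punctured ball lies in `{U < U σ}`. That punctured ball is empty if `dim S = 0`
and connected if `dim S ≥ 2`. Moreover from the projection one can climb straight to `σ`, which
gives an optimal path through the point `σ` found above.
-/

namespace MorsePotential

open Set Metric

section Topology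

variable {X : Type*} [TopologicalSpace X] {F : Set X} {x y σ : X}

/-- The set `F` is locally path connected at `σ`, which need not belong to `F`: any two points of
`F` close enough to `σ` are joined by a path in `F`. It is used for strict sublevel sets at a point
of their boundary. -/
def LocallyJoinedIn (F : Set X) (σ : X) : Prop :=
  ∃ W ∈ 𝓝 σ, ∀ p ∈ W ∩ F, ∀ q ∈ W ∩ F, JoinedIn F p q

theorem locallyJoinedIn_of_isOpen [LocallyPathConnectedSpace X] (hF : IsOpen F) (hσ : σ ∈ F) :
    LocallyJoinedIn F σ :=
  ⟨pathComponentIn F σ, (hF.pathComponentIn σ).mem_nhds (mem_pathComponentIn_self hσ),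
    fun _ hp _ hq => hp.1.symm.trans hq.1⟩

theorem not_locallyJoinedIn_of_mem_closure (hx : σ ∈ closure (pathComponentIn F x))
    (hy : σ ∈ closure (F \ pathComponentIn F x)) : ¬ LocallyJoinedIn F σ := by
  rintro ⟨W, hW, hjoin⟩
  obtain ⟨p, hpW, hp⟩ := mem_closure_iff_nhds.1 hx W hW
  obtain ⟨q, hqW, hqF, hq⟩ := mem_closure_iff_nhds.1 hy W hW
  exact hq (JoinedIn.trans hp (hjoin p ⟨hpW, pathComponentIn_subset hp⟩ q ⟨hqW, hqF⟩))

theorem LocallyJoinedIn.joinedIn_of_path {z : Path x y} {t₀ : unitInterval}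
    (h : LocallyJoinedIn F (z t₀)) (h0 : t₀ ≠ 0) (h1 : t₀ ≠ 1) (hz : ∀ t ≠ t₀, z t ∈ F) :
    JoinedIn F x y := by
  obtain ⟨W, hW, hjoin⟩ := h
  have hzW : ∀ᶠ t in 𝓝 t₀, z t ∈ W := z.continuous.continuousAt hW
  have : (𝓝[<] t₀).NeBot := nhdsLT_neBot_of_exists_lt ⟨0, unitInterval.pos_iff_ne_zero.2 h0⟩
  have : (𝓝[>] t₀).NeBot := nhdsGT_neBot_of_exists_gt ⟨1, unitInterval.lt_one_iff_ne_one.2 h1⟩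
  obtain ⟨a, haW, ha⟩ :=
    ((hzW.filter_mono nhdsWithin_le_nhds).and (self_mem_nhdsWithin (s := Iio t₀))).exists
  obtain ⟨b, hbW, hb⟩ :=
    ((hzW.filter_mono nhdsWithin_le_nhds).and (self_mem_nhdsWithin (s := Ioi t₀))).exists
  have hpiece : ∀ u v, u ≤ v → t₀ ∉ Icc u v → JoinedIn F (z u) (z v) := by
    refine fun u v huv hnot => ⟨z.subpath u v, fun t => ?_⟩
    obtain ⟨s, hs, hst⟩ := (z.range_subpath_of_le u v huv).subset (mem_range_self t)
    exact hst ▸ hz s (ne_of_mem_of_not_mem hs hnot)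
  have hxa := hpiece 0 a unitInterval.nonneg' fun h => h.2.not_gt ha
  have hby := hpiece b 1 unitInterval.le_one' fun h => h.1.not_gt hb
  have hab := hjoin _ ⟨haW, hxa.target_mem⟩ _ ⟨hbW, hby.source_mem⟩
  simpa using (hxa.trans hab).trans hby

/-- The point `σ` is accessible from `x` within `F`: some path from `x` to `σ` stays in `F` until
it reaches its end point. Two such paths are the halves of an optimal path. -/
def IsAccessibleIn (F : Set X) (x σ : X) : Prop :=
  ∃ γ : Path x σ, ∀ t ≠ 1, γ t ∈ F

theorem IsAccessibleIn.of_joinedIn (hxy : JoinedIn F x y) (hy : IsAccessibleIn F y σ) :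
    IsAccessibleIn F x σ := by
  obtain ⟨γ, hγ⟩ := hxy
  obtain ⟨δ, hδ⟩ := hy
  refine ⟨γ.trans δ, fun t ht => ?_⟩
  rw [Path.trans_apply]
  split_ifs with hle
  · exact hγ _
  · refine hδ _ fun h1 => ht (Subtype.ext ?_)
    have := congrArg Subtype.val h1
    simp only [Icc.coe_one] at this ⊢
    linarith

theorem IsAccessibleIn.exists_path (hx : IsAccessibleIn F x σ) (hy : IsAccessibleIn F y σ) :
    ∃ z : Path x y, z half = σ ∧ ∀ t ≠ half, z t ∈ F := by
  obtain ⟨γ, hγ⟩ := hx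
  obtain ⟨δ, hδ⟩ := hy
  refine ⟨γ.trans δ.symm, ?_, fun t ht => ?_⟩
  · rw [Path.trans_apply, dif_pos (show (half : ℝ) ≤ 1 / 2 from le_rfl)]
    exact (congrArg γ (Subtype.ext (by simp [half]))).trans γ.target
  · have ht' : (t : ℝ) ≠ 1 / 2 := fun h => ht (Subtype.ext h)
    rw [Path.trans_apply]
    split_ifs with hle
    · refine hγ _ fun h1 => ht' ?_
      have := congrArg Subtype.val h1
      simp only [Icc.coe_one] at this
      linarith
    · refine hδ _ fun h1 => ht' ?_
      have := congrArg Subtype.val h1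
      simp only [Icc.coe_one, unitInterval.coe_symm_eq] at this
      linarith

end Topology

section Sublevel

variable {X : Type*} [TopologicalSpace X] {U : X → ℝ} {c : ℝ} {m m' x y : X}

theorem isCompact_sublevel (hU : Continuous U) (hcoer : Tendsto U (cocompact X) atTop) (c : ℝ) :
    IsCompact {p | U p ≤ c} := by
  obtain ⟨K, hK, hKc⟩ := mem_cocompact.1 (hcoer.eventually_gt_atTop c)
  exact hK.of_isClosed_subset (isClosed_le hU continuous_const)
    fun p hp => by_contra fun hpK => (show c < U p from hKc hpK).not_ge hp

theorem eq_of_mem_closure_pathComponentIn [LocallyPathConnectedSpace X] (hU : Continuous U)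
    (hx : x ∈ closure (pathComponentIn {p | U p < c} m))
    (hx' : x ∈ closure ({p | U p < c} \ pathComponentIn {p | U p < c} m)) : U x = c := by
  have hsub : closure (pathComponentIn {p | U p < c} m) ⊆ {p | U p ≤ c} :=
    closure_minimal (pathComponentIn_subset.trans fun p (hp : U p < c) => hp.le)
      (isClosed_le hU continuous_const)
  refine (hsub hx).eq_of_not_lt fun hlt => not_locallyJoinedIn_of_mem_closure hx hx' ?_
  exact locallyJoinedIn_of_isOpen (isOpen_lt hU continuous_const) hlt

theorem exists_isLocalMin_joinedIn [LocallyPathConnectedSpace X] (hU : Continuous U)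
    (hcoer : Tendsto U (cocompact X) atTop) (hy : U y < c) :
    ∃ p, IsLocalMin U p ∧ JoinedIn {q | U q < c} y p := by
  have hopen : IsOpen {q | U q < c} := isOpen_lt hU continuous_const
  set B := pathComponentIn {q | U q < c} y
  have hBopen : IsOpen B := hopen.pathComponentIn y
  have hyB : y ∈ B := mem_pathComponentIn_self hy
  have hBlt : ∀ q ∈ B, U q < c := fun q hq => pathComponentIn_subset (F := {q | U q < c}) hq
  have hcompact : IsCompact (closure B) :=
    (isCompact_sublevel hU hcoer c).of_isClosed_subset isClosed_closure
      (closure_minimal (fun q hq => (hBlt q hq).le) (isClosed_le hU continuous_const))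
  obtain ⟨p, hp, hmin⟩ := hcompact.exists_isMinOn ⟨y, subset_closure hyB⟩ hU.continuousOn
  have hpc : U p < c := (hmin (subset_closure hyB)).trans_lt hy
  obtain ⟨q, hpq, hyq⟩ := mem_closure_iff.1 hp _ (hopen.pathComponentIn p)
    (mem_pathComponentIn_self hpc)
  have hpB : p ∈ B := JoinedIn.trans hyq (JoinedIn.symm hpq)
  exact ⟨p, (hmin.on_subset subset_closure).isLocalMin (hBopen.mem_nhds hpB), hpB⟩

theorem exists_sublevel_subset_of_isOpen (hU : Continuous U)
    (hcoer : Tendsto U (cocompact X) atTop) {O : Set X} (hO : IsOpen O) (hsub : {p | U p ≤ c} ⊆ O) :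
    ∃ e > c, {p | U p < e} ⊆ O := by
  have hK : IsCompact ({p | U p ≤ c + 1} \ O) := (isCompact_sublevel hU hcoer _).diff hO
  obtain ⟨e, hce, he⟩ := hK.exists_forall_le' hU.continuousOn
    fun p hp => not_le.1 fun hpc => hp.2 (hsub hpc)
  refine ⟨min e (c + 1), lt_min hce (lt_add_one c), fun p hp => by_contra fun hpO => ?_⟩
  have hp' := lt_min_iff.1 (show U p < min e (c + 1) from hp)
  exact hp'.1.not_ge (he p ⟨hp'.2.le, hpO⟩)

variable [NormalSpace X]

theorem exists_gt_not_joinedIn (hU : Continuous U) (hcoer : Tendsto U (cocompact X) atTop)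
    {C D : Set X} (hC : IsClosed C) (hD : IsClosed D) (hCD : Disjoint C D)
    (hsub : {p | U p ≤ c} ⊆ C ∪ D) (hx : x ∈ C) (hy : y ∈ D) :
    ∃ e > c, ¬ JoinedIn {p | U p < e} x y := by
  obtain ⟨O₁, O₂, hO₁, hO₂, hC₁, hD₂, hO⟩ := normal_separation hC hD hCD
  obtain ⟨e, hce, he⟩ := exists_sublevel_subset_of_isOpen hU hcoer (hO₁.union hO₂)
    (hsub.trans (union_subset_union hC₁ hD₂))
  refine ⟨e, hce, fun ⟨z, hz⟩ => ?_⟩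
  obtain ⟨p, -, hp₁, hp₂⟩ := isPreconnected_range z.continuous O₁ O₂ hO₁ hO₂
    (range_subset_iff.2 fun t => he (hz t)) ⟨x, ⟨0, z.source⟩, hC₁ hx⟩ ⟨y, ⟨1, z.target⟩, hD₂ hy⟩
  exact disjoint_left.1 hO hp₁ hp₂

theorem exists_gt_not_joinedIn_of_strict_localMin [T1Space X] (hU : Continuous U)
    (hcoer : Tendsto U (cocompact X) atTop) (hm : ∀ᶠ p in 𝓝[≠] m, U m < U p) (hne : m' ≠ m) :
    ∃ e > U m, ¬ JoinedIn {p | U p < e} m m' := by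
  rcases lt_or_ge (U m) (U m') with hlt | hle
  · exact ⟨U m', hlt, fun h => lt_irrefl (U m') h.target_mem⟩
  obtain ⟨O, hOm, hO, hmO⟩ := eventually_nhds_iff.1 (eventually_nhdsWithin_iff.1 hm)
  have hout : ∀ p, U p ≤ U m → p ≠ m → p ∈ Oᶜ := fun p hp hpm hpO => (hOm p hpO hpm).not_ge hp
  exact exists_gt_not_joinedIn hU hcoer isClosed_singleton hO.isClosed_compl
    (disjoint_singleton_left.2 fun h => h hmO)
    (fun p hp => or_iff_not_imp_left.2 (hout p hp)) (mem_singleton m) (hout m' hle hne)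

theorem exists_mem_closure_pathComponentIn_inter_closure [T1Space X] (hU : Continuous U)
    (hcoer : Tendsto U (cocompact X) atTop) (hfin : {p | IsLocalMin U p ∧ U p = c}.Finite)
    (hm : U m < c) (hm' : IsLocalMin U m') (hnot : ¬ JoinedIn {p | U p < c} m m')
    (hjoin : ∀ e > c, JoinedIn {p | U p < e} m m') :
    ∃ σ ∈ closure (pathComponentIn {p | U p < c} m),
      σ ∈ closure ({p | U p < c} \ pathComponentIn {p | U p < c} m) := by
  set A := pathComponentIn {p | U p < c} m
  set B := {p | U p < c} \ A
  by_contra! hdisj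
  have hcover : ∀ p, U p ≤ c → p ∈ closure A ∪ (closure B ∪ {p | IsLocalMin U p ∧ U p = c}) := by
    intro p hp
    by_cases hcl : p ∈ closure {q | U q < c}
    · rw [← union_assoc, ← closure_union, union_sdiff_cancel pathComponentIn_subset]
      exact Or.inl hcl
    · have hloc : ∀ᶠ q in 𝓝 p, c ≤ U q := by
        simpa [mem_closure_iff_frequently, not_frequently] using hcl
      have hpc : U p = c := hp.antisymm hloc.self_of_nhds
      exact Or.inr (Or.inr ⟨hloc.mono fun q hq => hpc.trans_le hq, hpc⟩)
  have hdisjoint : Disjoint (closure A) (closure B ∪ {p | IsLocalMin U p ∧ U p = c}) := by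
    refine disjoint_union_right.2 ⟨disjoint_left.2 hdisj, disjoint_left.2 fun p hpA hp => ?_⟩
    obtain ⟨q, hpq, hqA⟩ := mem_closure_iff_nhds.1 hpA _ hp.1
    have hqc : U q < c := pathComponentIn_subset (F := {p | U p < c}) hqA
    exact hqc.not_ge (hp.2.symm.trans_le hpq)
  have hm'c : U m' ≤ c := le_of_forall_gt fun e he => (hjoin e he).target_mem
  have hm'D : m' ∈ closure B ∪ {p | IsLocalMin U p ∧ U p = c} :=
    hm'c.lt_or_eq.imp (fun hlt => subset_closure ⟨hlt, hnot⟩) fun heq => ⟨hm', heq⟩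
  obtain ⟨e, hce, he⟩ := exists_gt_not_joinedIn hU hcoer isClosed_closure
    (isClosed_closure.union hfin.isClosed) hdisjoint hcover
    (subset_closure (mem_pathComponentIn_self hm)) hm'D
  exact he (hjoin e hce)

end Sublevel

section Convexity

theorem convex_setOf_sub_mem {E : Type*} [AddCommGroup E] [Module ℝ E] (S : Submodule ℝ E)
    (x : E) : Convex ℝ {y | y - x ∈ S} :=
  S.convex.affine_preimage (AffineMap.id ℝ E - AffineMap.const ℝ E x)

variable {E : Type*} [NormedAddCommGroup E] [NormedSpace ℝ E] {U : E → ℝ} {s : Set E} {σ x : E}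

theorem strictConvexOn_of_fderiv_fderiv_pos (hU : ContDiff ℝ 2 U) (hs : Convex ℝ s)
    (hpos : ∀ x ∈ s, ∀ y ∈ s, x ≠ y → ∀ z ∈ s, 0 < fderiv ℝ (fderiv ℝ U) z (y - x) (y - x)) :
    StrictConvexOn ℝ s U := by
  refine ⟨hs, fun x hx y hy hxy a b ha hb hab => ?_⟩
  have hderiv : ∀ t : ℝ, HasDerivAt (fun t => U (AffineMap.lineMap x y t))
      (fderiv ℝ U (AffineMap.lineMap x y t) (y - x)) t := fun t =>
    (hU.differentiable (by norm_num) _).hasFDerivAt.comp_hasDerivAt t AffineMap.hasDerivAt_lineMap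
  have hderiv2 : ∀ t : ℝ, HasDerivAt (fun t => fderiv ℝ U (AffineMap.lineMap x y t) (y - x))
      (fderiv ℝ (fderiv ℝ U) (AffineMap.lineMap x y t) (y - x) (y - x)) t := fun t => by
    have hU' := (hU.fderiv_right (m := 1) le_rfl).differentiable one_ne_zero
    simpa using ((hU' _).hasFDerivAt.comp_hasDerivAt t AffineMap.hasDerivAt_lineMap).clm_apply
      (hasDerivAt_const t (y - x))
  have hline : StrictConvexOn ℝ (Icc 0 1) fun t : ℝ => U (AffineMap.lineMap x y t) := by
    refine strictConvexOn_of_deriv2_pos' (convex_Icc 0 1)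
      (fun t _ => (hderiv t).continuousAt.continuousWithinAt) fun t ht => ?_
    rw [Function.iterate_succ_apply', Function.iterate_one, funext fun t => (hderiv t).deriv,
      (hderiv2 t).deriv]
    exact hpos x hx y hy hxy _ (hs.lineMap_mem hx hy ht)
  obtain rfl : a = 1 - b := eq_sub_of_add_eq hab
  have := hline.2 (left_mem_Icc.2 zero_le_one) (right_mem_Icc.2 zero_le_one) zero_ne_one ha hb hab
  simpa [AffineMap.lineMap_apply_module] using this

theorem isMinOn_of_convexOn_of_hasFDerivAt_zero (hU : ConvexOn ℝ s U) (hσs : σ ∈ s)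
    (hσ : HasFDerivAt U (0 : E →L[ℝ] ℝ) σ) : IsMinOn U s σ := by
  intro y hy
  have hline := hU.comp_affineMap (AffineMap.lineMap σ y)
  have hderiv : HasDerivAt (U ∘ AffineMap.lineMap (k := ℝ) σ y) 0 0 := by
    refine HasFDerivAt.comp_hasDerivAt (l' := 0) 0 ?_ AffineMap.hasDerivAt_lineMap
    simpa using hσ
  have := hline.le_slope_of_hasDerivAt (by simpa using hσs) (by simpa using hy) zero_lt_one hderiv
  simpa [slope] using this

theorem lt_of_strictConvexOn_of_hasFDerivAt_zero (hU : StrictConvexOn ℝ s U) (hσs : σ ∈ s)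
    (hσ : HasFDerivAt U (0 : E →L[ℝ] ℝ) σ) (hx : x ∈ s) (hne : x ≠ σ) : U σ < U x := by
  have hmin := isMinOn_of_convexOn_of_hasFDerivAt_zero hU.convexOn hσs hσ
  refine (hmin hx).lt_of_ne fun heq => hne (hU.eq_of_isMinOn (fun y hy => ?_) hmin hx hσs)
  exact heq.symm.trans_le (hmin hy)

end Convexity

section Noncritical

variable {E : Type*} [NormedAddCommGroup E] [NormedSpace ℝ E] [CompleteSpace E] {U : E → ℝ} {σ : E}

theorem locallyJoinedIn_of_hasStrictFDerivAt {f' : E →L[ℝ] ℝ} (hf : HasStrictFDerivAt U f' σ)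
    (hf' : f' ≠ 0) (c : ℝ) : LocallyJoinedIn {x | U x < c} σ := by
  have hrange : f'.range = ⊤ :=
    LinearMap.range_eq_top.2 (LinearMap.surjective fun h => hf' (ContinuousLinearMap.coe_inj.1 h))
  set φ := hf.implicitToOpenPartialHomeomorph U f' hrange
  have hφ : ∀ x, (φ x).1 = U x := hf.implicitToOpenPartialHomeomorph_fst hrange
  have hσ : σ ∈ φ.source := hf.mem_implicitToOpenPartialHomeomorph_source hrange
  obtain ⟨ε, hε, hball⟩ := Metric.isOpen_iff.1 φ.open_target _ (φ.map_source hσ)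
  have hconvex : Convex ℝ (ball (φ σ) ε ∩ {p | p.1 < c}) :=
    (convex_ball _ _).inter (convex_halfSpace_lt (LinearMap.fst ℝ ℝ _).isLinear c)
  refine ⟨φ.source ∩ φ ⁻¹' ball (φ σ) ε, inter_mem (φ.open_source.mem_nhds hσ)
    (φ.continuousAt hσ (ball_mem_nhds _ hε)), ?_⟩
  rintro p ⟨⟨hp, hpε⟩, hpc⟩ q ⟨⟨hq, hqε⟩, hqc⟩
  have hjoin := JoinedIn.of_segment_subset (hconvex.segment_subset
    ⟨hpε, (hφ p).trans_lt hpc⟩ ⟨hqε, (hφ q).trans_lt hqc⟩)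
  have := hjoin.map_continuousOn (φ.continuousOn_symm.mono (inter_subset_left.trans hball))
  rw [φ.left_inv hp, φ.left_inv hq] at this
  refine this.mono ?_
  rintro _ ⟨w, ⟨hwε, hwc⟩, rfl⟩
  rw [mem_ofPred_eq, ← hφ, φ.right_inv (hball hwε)]
  exact hwc

end Noncritical

section QuadraticForms

variable {X E : Type*} [TopologicalSpace X] [NormedAddCommGroup E] [NormedSpace ℝ E]
  [FiniteDimensional ℝ E]

theorem eventually_forall_mem_pos {B : X → E →L[ℝ] E →L[ℝ] ℝ} (hB : Continuous B)
    {S : Submodule ℝ E} {σ : X} (hpos : ∀ v ∈ S, v ≠ 0 → 0 < B σ v v) :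
    ∀ᶠ x in 𝓝 σ, ∀ v ∈ S, v ≠ 0 → 0 < B x v v := by
  have hcompact : IsCompact (sphere (0 : E) 1 ∩ S) :=
    (isCompact_sphere 0 1).inter_right S.closed_of_finiteDimensional
  have hsphere : ∀ᶠ x in 𝓝 σ, ∀ v ∈ sphere (0 : E) 1 ∩ S, 0 < B x v v := by
    refine hcompact.eventually_forall_of_forall_eventually fun v hv => ?_
    have hcont : Continuous fun p : X × E => B p.1 p.2 p.2 := by fun_prop
    exact hcont.continuousAt.eventually_const_lt
      (hpos v hv.2 (ne_zero_of_mem_unit_sphere ⟨v, hv.1⟩))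
  filter_upwards [hsphere] with x hx v hvS hv
  have hunit := hx (‖v‖⁻¹ • v) ⟨by simp [norm_smul, hv], S.smul_mem _ hvS⟩
  simp only [map_smul, smul_apply, smul_eq_mul] at hunit
  have hinv : 0 < ‖v‖⁻¹ := inv_pos.2 (norm_pos_iff.2 hv)
  exact (mul_pos_iff_of_pos_left hinv).1 ((mul_pos_iff_of_pos_left hinv).1 hunit)

end QuadraticForms

section PuncturedBall

variable {E : Type*} [NormedAddCommGroup E] [NormedSpace ℝ E]

theorem isPathConnected_ball_sdiff_center (hE : 1 < Module.rank ℝ E) (x : E) {r : ℝ} (hr : 0 < r) :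
    IsPathConnected (ball x r \ {x}) := by
  have himage : OpenPartialHomeomorph.univBall x r '' {0}ᶜ = ball x r \ {x} := by
    have hinj : InjOn (OpenPartialHomeomorph.univBall x r) univ := by
      simpa using (OpenPartialHomeomorph.univBall x r).injOn
    have hball : OpenPartialHomeomorph.univBall x r '' univ = ball x r := by
      simpa [OpenPartialHomeomorph.univBall_target x hr] using
        (OpenPartialHomeomorph.univBall x r).image_source_eq_target
    rw [compl_eq_univ_sdiff, hinj.image_sdiff, univ_inter, hball, image_singleton,
      OpenPartialHomeomorph.univBall_apply_zero]
  rw [← himage]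
  exact (isPathConnected_compl_singleton_of_one_lt_rank hE 0).image
    (OpenPartialHomeomorph.continuous_univBall x r)

end PuncturedBall

section Splitting

variable {E : Type*} [NormedAddCommGroup E] [InnerProductSpace ℝ E] {U : E → ℝ} {σ x y : E}
  {S : Submodule ℝ E} {r : ℝ}

/-- A second-order splitting of `U` at the critical point `σ`: on the ball of radius `r` around `σ`,
`U` is strictly concave on the slice through `σ` parallel to `S` and strictly convex on every slice
parallel to `Sᗮ`. It replaces the Morse lemma. -/
structure IsMorseSplitting (U : E → ℝ) (σ : E) (S : Submodule ℝ E) (r : ℝ) : Prop where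
  radius_pos : 0 < r
  hasFDerivAt_zero : HasFDerivAt U (0 : E →L[ℝ] ℝ) σ
  strictConcaveOn : StrictConcaveOn ℝ (ball σ r ∩ {y | y - σ ∈ S}) U
  strictConvexOn : ∀ x, StrictConvexOn ℝ (ball σ r ∩ {y | y - x ∈ Sᗮ}) U

theorem exists_isMorseSplitting [FiniteDimensional ℝ E] (hU : ContDiff ℝ 2 U)
    (hσ : fderiv ℝ U σ = 0) (hneg : ∀ v ∈ S, v ≠ 0 → fderiv ℝ (fderiv ℝ U) σ v v < 0)
    (hpos : ∀ v ∈ Sᗮ, v ≠ 0 → 0 < fderiv ℝ (fderiv ℝ U) σ v v) :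
    ∃ r, IsMorseSplitting U σ S r := by
  have hcont : Continuous (fderiv ℝ (fderiv ℝ U)) :=
    (hU.fderiv_right (m := 1) le_rfl).continuous_fderiv one_ne_zero
  have hnegσ : ∀ᶠ x in 𝓝 σ, ∀ v ∈ S, v ≠ 0 → 0 < -fderiv ℝ (fderiv ℝ U) x v v :=
    eventually_forall_mem_pos hcont.neg fun v hv hv0 => neg_pos.2 (hneg v hv hv0)
  obtain ⟨r, hr, hball⟩ :=
    eventually_nhds_iff_ball.1 (hnegσ.and (eventually_forall_mem_pos hcont hpos))
  refine ⟨r, hr, hσ ▸ (hU.differentiable (by norm_num) σ).hasFDerivAt, neg_strictConvexOn_iff.1 ?_,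
    fun x => ?_⟩
  · refine strictConvexOn_of_fderiv_fderiv_pos hU.neg
      ((convex_ball _ _).inter (convex_setOf_sub_mem _ _)) fun y hy w hw hyw z hz => ?_
    have hmem : w - y ∈ S := by simpa using S.sub_mem hw.2 hy.2
    have hfderiv : fderiv ℝ (-U) = -fderiv ℝ U := funext fun _ => fderiv_neg
    rw [hfderiv, fderiv_neg]
    exact (hball z hz.1).1 _ hmem (sub_ne_zero.2 hyw.symm)
  · refine strictConvexOn_of_fderiv_fderiv_pos hU
      ((convex_ball _ _).inter (convex_setOf_sub_mem _ _)) fun y hy w hw hyw z hz => ?_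
    have hmem : w - y ∈ Sᗮ := by simpa using Sᗮ.sub_mem hw.2 hy.2
    exact (hball z hz.1).2 _ hmem (sub_ne_zero.2 hyw.symm)

/-- The orthogonal projection of `x` to the affine subspace `σ + S`, to which points below the level
of `σ` are moved. -/
noncomputable def foot (S : Submodule ℝ E) [S.HasOrthogonalProjection] (σ x : E) : E :=
  σ + S.starProjection (x - σ)

theorem foot_mem_ball [S.HasOrthogonalProjection] (hx : x ∈ ball σ r) : foot S σ x ∈ ball σ r := by
  simp only [mem_ball_iff_norm, foot, add_sub_cancel_left] at hx ⊢
  exact (S.norm_starProjection_apply_le _).trans_lt hx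

theorem sub_foot_mem_orthogonal (S : Submodule ℝ E) [S.HasOrthogonalProjection] (σ x : E) :
    x - foot S σ x ∈ Sᗮ := by
  rw [foot, ← sub_sub]
  exact S.sub_starProjection_mem_orthogonal _

theorem foot_sub_mem (S : Submodule ℝ E) [S.HasOrthogonalProjection] (σ x : E) :
    foot S σ x - σ ∈ S := by
  rw [foot, add_sub_cancel_left]
  exact S.starProjection_apply_mem _

namespace IsMorseSplitting

theorem lt_of_sub_mem (h : IsMorseSplitting U σ S r) (hx : x ∈ ball σ r) (hxS : x - σ ∈ S)
    (hne : x ≠ σ) : U x < U σ := by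
  have hneg := lt_of_strictConvexOn_of_hasFDerivAt_zero h.strictConcaveOn.neg
    ⟨mem_ball_self h.radius_pos, by simp⟩ (by simpa using h.hasFDerivAt_zero.neg) ⟨hx, hxS⟩ hne
  exact neg_lt_neg_iff.1 hneg

theorem le_of_sub_mem_orthogonal (h : IsMorseSplitting U σ S r) (hx : x ∈ ball σ r)
    (hxS : x - σ ∈ Sᗮ) : U σ ≤ U x :=
  isMinOn_of_convexOn_of_hasFDerivAt_zero (h.strictConvexOn σ).convexOn
    ⟨mem_ball_self h.radius_pos, by simp⟩ h.hasFDerivAt_zero ⟨hx, hxS⟩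

theorem locallyJoinedIn_of_bot (h : IsMorseSplitting U σ ⊥ r) :
    LocallyJoinedIn {x | U x < U σ} σ :=
  ⟨ball σ r, ball_mem_nhds σ h.radius_pos, fun _ hp =>
    absurd hp.2 (h.le_of_sub_mem_orthogonal hp.1 (by simp)).not_gt⟩

variable [S.HasOrthogonalProjection]

theorem foot_ne (h : IsMorseSplitting U σ S r) (hx : x ∈ ball σ r) (hlt : U x < U σ) :
    foot S σ x ≠ σ := fun hfoot =>
  hlt.not_ge (h.le_of_sub_mem_orthogonal hx (hfoot ▸ sub_foot_mem_orthogonal S σ x))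

theorem joinedIn_foot (h : IsMorseSplitting U σ S r) (hx : x ∈ ball σ r) (hlt : U x < U σ) :
    JoinedIn {y | U y < U σ} x (foot S σ x) := by
  have hfoot : U (foot S σ x) < U σ :=
    h.lt_of_sub_mem (foot_mem_ball hx) (foot_sub_mem S σ x) (h.foot_ne hx hlt)
  refine JoinedIn.of_segment_subset fun z hz => ?_
  exact ((h.strictConvexOn (foot S σ x)).convexOn.le_max_of_mem_segment
    ⟨hx, sub_foot_mem_orthogonal S σ x⟩ ⟨foot_mem_ball hx, by simp⟩ hz).trans_lt (max_lt hlt hfoot)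

theorem isAccessibleIn (h : IsMorseSplitting U σ S r) (hx : x ∈ ball σ r) (hlt : U x < U σ) :
    IsAccessibleIn {y | U y < U σ} x σ := by
  refine .of_joinedIn (h.joinedIn_foot hx hlt) ⟨Path.segment (foot S σ x) σ, fun t ht => ?_⟩
  have hsub : Path.segment (foot S σ x) σ t - σ = (1 - (t : ℝ)) • (foot S σ x - σ) := by
    rw [Path.segment_apply, AffineMap.lineMap_apply_module]
    module
  refine h.lt_of_sub_mem ?_ (hsub ▸ S.smul_mem _ (foot_sub_mem S σ x)) (sub_ne_zero.1 ?_)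
  · rw [Path.segment_apply]
    exact (convex_ball σ r).lineMap_mem (foot_mem_ball hx) (mem_ball_self h.radius_pos) t.2
  · have ht' : (t : ℝ) ≠ 1 := fun h1 => ht (Subtype.ext h1)
    exact hsub ▸ smul_ne_zero (sub_ne_zero.2 ht'.symm) (sub_ne_zero.2 (h.foot_ne hx hlt))

theorem locallyJoinedIn_of_one_lt_rank (h : IsMorseSplitting U σ S r)
    (hS : 1 < Module.rank ℝ S) : LocallyJoinedIn {x | U x < U σ} σ := by
  refine ⟨ball σ r, ball_mem_nhds σ h.radius_pos, fun p ⟨hp, hpσ⟩ q ⟨hq, hqσ⟩ => ?_⟩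
  refine (h.joinedIn_foot hp hpσ).trans (.trans ?_ (h.joinedIn_foot hq hqσ).symm)
  have hfoot : ∀ x ∈ ball σ r, U x < U σ →
      ∃ v ∈ ball (0 : S) r \ {0}, σ + (v : E) = foot S σ x := fun x hx hlt =>
    ⟨⟨foot S σ x - σ, foot_sub_mem S σ x⟩,
      ⟨by simpa [dist_eq_norm] using foot_mem_ball (S := S) hx,
        by simpa [sub_eq_zero] using h.foot_ne hx hlt⟩,
      add_sub_cancel σ _⟩
  obtain ⟨v, hv, hvp⟩ := hfoot p hp hpσ
  obtain ⟨w, hw, hwq⟩ := hfoot q hq hqσ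
  have hjoin := ((isPathConnected_ball_sdiff_center hS 0 h.radius_pos).joinedIn v hv w hw).map
    (f := fun u : S => σ + (u : E)) (by fun_prop)
  rw [hvp, hwq] at hjoin
  refine hjoin.mono ?_
  rintro _ ⟨u, ⟨hu, hu0⟩, rfl⟩
  exact h.lt_of_sub_mem (by simpa [mem_ball_iff_norm] using hu) (by simp) (by simpa using hu0)

end IsMorseSplitting

end Splitting

section Spectral

variable {n : Type*} [Fintype n] [DecidableEq n] {A : Matrix n n ℝ} {v : EuclideanSpace ℝ n}

theorem dotProduct_mulVec_eq_sum_eigenvalues (hA : A.IsHermitian) (v : EuclideanSpace ℝ n) :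
    v.ofLp ⬝ᵥ A.mulVec v.ofLp =
      ∑ i, hA.eigenvalues i * inner ℝ (hA.eigenvectorBasis i) v ^ 2 := by
  have hA' : ∀ i, v.ofLp ⬝ᵥ A.mulVec (hA.eigenvectorBasis i).ofLp =
      hA.eigenvalues i * inner ℝ (hA.eigenvectorBasis i) v := fun i => by
    rw [hA.mulVec_eigenvectorBasis, dotProduct_smul]
    simp [EuclideanSpace.inner_eq_star_dotProduct]
  conv_lhs => enter [2, 2]; rw [← hA.eigenvectorBasis.sum_repr' v]
  simp only [WithLp.ofLp_sum, WithLp.ofLp_smul, Matrix.mulVec_sum, Matrix.mulVec_smul,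
    dotProduct_sum, dotProduct_smul, hA', smul_eq_mul]
  exact Finset.sum_congr rfl fun i _ => by ring

theorem eigenvalues_ne_zero_of_det_ne_zero (hA : A.IsHermitian) (hdet : A.det ≠ 0) (i : n) :
    hA.eigenvalues i ≠ 0 := fun h => by
  rw [hA.det_eq_prod_eigenvalues] at hdet
  exact hdet (Finset.prod_eq_zero (Finset.mem_univ i) (by simp [h]))

/-- The negative space of a real symmetric matrix: the span of its eigenvectors with negative
eigenvalue. At a critical point of `U` it is the subspace along which the Hessian splits `U`. -/
noncomputable def negSpace (hA : A.IsHermitian) : Submodule ℝ (EuclideanSpace ℝ n) :=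
  Submodule.span ℝ (range fun i : {i // hA.eigenvalues i < 0} => hA.eigenvectorBasis i)

theorem finrank_negSpace (hA : A.IsHermitian) :
    Module.finrank ℝ (negSpace hA) = Fintype.card {i // hA.eigenvalues i < 0} :=
  finrank_span_eq_card
    (hA.eigenvectorBasis.orthonormal.linearIndependent.comp _ Subtype.val_injective)

theorem inner_eigenvectorBasis_eq_zero_of_mem_negSpace {hA : A.IsHermitian} {i : n}
    (hi : 0 ≤ hA.eigenvalues i) (hv : v ∈ negSpace hA) :
    inner ℝ (hA.eigenvectorBasis i) v = 0 := by
  have hle : negSpace hA ≤ (ℝ ∙ hA.eigenvectorBasis i)ᗮ := by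
    refine Submodule.span_le.2 ?_
    rintro _ ⟨j, rfl⟩
    rw [SetLike.mem_coe, Submodule.mem_orthogonal_singleton_iff_inner_right]
    exact hA.eigenvectorBasis.orthonormal.2 fun hij => (hij ▸ j.2).not_ge hi
  exact Submodule.mem_orthogonal_singleton_iff_inner_right.1 (hle hv)

theorem exists_inner_eigenvectorBasis_ne_zero (hA : A.IsHermitian) (hv : v ≠ 0) :
    ∃ i, inner ℝ (hA.eigenvectorBasis i) v ≠ 0 := by
  by_contra! h
  exact hv (by simpa [h] using (hA.eigenvectorBasis.sum_repr' v).symm)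

theorem dotProduct_mulVec_neg_of_mem_negSpace {hA : A.IsHermitian} (hv : v ∈ negSpace hA)
    (hv0 : v ≠ 0) : v.ofLp ⬝ᵥ A.mulVec v.ofLp < 0 := by
  rw [dotProduct_mulVec_eq_sum_eigenvalues hA]
  have hneg : ∀ i, inner ℝ (hA.eigenvectorBasis i) v ≠ 0 → hA.eigenvalues i < 0 := fun i h =>
    not_le.1 fun hi => h (inner_eigenvectorBasis_eq_zero_of_mem_negSpace hi hv)
  obtain ⟨i, hi⟩ := exists_inner_eigenvectorBasis_ne_zero hA hv0
  refine Finset.sum_neg' (fun j _ => ?_)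
    ⟨i, Finset.mem_univ i, mul_neg_of_neg_of_pos (hneg i hi) (sq_pos_of_ne_zero hi)⟩
  rcases eq_or_ne (inner ℝ (hA.eigenvectorBasis j) v) 0 with hj | hj
  · simp [hj]
  · exact mul_nonpos_of_nonpos_of_nonneg (hneg j hj).le (sq_nonneg _)

theorem dotProduct_mulVec_pos_of_mem_negSpace_orthogonal {hA : A.IsHermitian} (hdet : A.det ≠ 0)
    (hv : v ∈ (negSpace hA)ᗮ) (hv0 : v ≠ 0) : 0 < v.ofLp ⬝ᵥ A.mulVec v.ofLp := by
  rw [dotProduct_mulVec_eq_sum_eigenvalues hA]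
  have hpos : ∀ i, inner ℝ (hA.eigenvectorBasis i) v ≠ 0 → 0 < hA.eigenvalues i := fun i h => by
    refine (not_lt.1 fun hi => h ?_).lt_of_ne' (eigenvalues_ne_zero_of_det_ne_zero hA hdet i)
    have hmem : hA.eigenvectorBasis i ∈ negSpace hA := Submodule.subset_span ⟨⟨i, hi⟩, rfl⟩
    exact Submodule.inner_right_of_mem_orthogonal hmem hv
  obtain ⟨i, hi⟩ := exists_inner_eigenvectorBasis_ne_zero hA hv0
  refine Finset.sum_pos' (fun j _ => ?_)
    ⟨i, Finset.mem_univ i, mul_pos (hpos i hi) (sq_pos_of_ne_zero hi)⟩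
  rcases eq_or_ne (inner ℝ (hA.eigenvectorBasis j) v) 0 with hj | hj
  · simp [hj]
  · exact mul_nonneg (hpos j hj).le (sq_nonneg _)

end Spectral

section Hessian

variable {d : ℕ} {U : EuclideanSpace ℝ (Fin d) → ℝ} {σ : EuclideanSpace ℝ (Fin d)}

theorem gradient_eq_zero_iff : gradient U σ = 0 ↔ fderiv ℝ U σ = 0 := by
  simp [gradient]

theorem isHermitian_hessian (hU : ContDiff ℝ 2 U) (σ : EuclideanSpace ℝ (Fin d)) :
    (hessian U σ).IsHermitian := by
  ext i j
  have hsymm := (hU.contDiffAt (x := σ)).isSymmSndFDerivAt (by simp)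
  simpa [hessian] using hsymm.eq (EuclideanSpace.single j 1) (EuclideanSpace.single i 1)

theorem fderiv_fderiv_apply (v w : EuclideanSpace ℝ (Fin d)) :
    fderiv ℝ (fderiv ℝ U) σ v w = v.ofLp ⬝ᵥ (hessian U σ).mulVec w.ofLp := by
  have hsum : ∀ u : EuclideanSpace ℝ (Fin d), u = ∑ i, u i • EuclideanSpace.single i (1 : ℝ) :=
    fun u => by simpa using ((EuclideanSpace.basisFun (Fin d) ℝ).sum_repr u).symm
  conv_lhs => rw [hsum v, hsum w]
  simp only [map_sum, map_smul, sum_apply, smul_apply,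
    smul_eq_mul, dotProduct, Matrix.mulVec, hessian, Matrix.of_apply, Finset.mul_sum]
  rw [Finset.sum_comm]
  exact Finset.sum_congr rfl fun i _ => Finset.sum_congr rfl fun j _ => by ring

theorem exists_isMorseSplitting_negSpace (hU : ContDiff ℝ 2 U) (hσ : gradient U σ = 0)
    (hH : (hessian U σ).IsHermitian) (hdet : (hessian U σ).det ≠ 0) :
    ∃ r, IsMorseSplitting U σ (negSpace hH) r := by
  refine exists_isMorseSplitting hU (gradient_eq_zero_iff.1 hσ) (fun v hv hv0 => ?_)
    fun v hv hv0 => ?_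
  · exact fderiv_fderiv_apply v v ▸ dotProduct_mulVec_neg_of_mem_negSpace hv hv0
  · exact fderiv_fderiv_apply v v ▸ dotProduct_mulVec_pos_of_mem_negSpace_orthogonal hdet hv hv0

theorem gradient_eq_zero_of_not_locallyJoinedIn (hU : ContDiff ℝ 2 U)
    (hσ : ¬ LocallyJoinedIn {x | U x < U σ} σ) : gradient U σ = 0 :=
  not_not.1 fun hgrad => hσ <| locallyJoinedIn_of_hasStrictFDerivAt
    (hU.contDiffAt.hasStrictFDerivAt two_ne_zero) (mt gradient_eq_zero_iff.2 hgrad) _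

theorem isSaddlePoint_of_not_locallyJoinedIn (hU : ContDiff ℝ 2 U)
    (hdet : gradient U σ = 0 → (hessian U σ).det ≠ 0)
    (hσ : ¬ LocallyJoinedIn {x | U x < U σ} σ) : IsSaddlePoint U σ := by
  have hgrad := gradient_eq_zero_of_not_locallyJoinedIn hU hσ
  have hH := isHermitian_hessian hU σ
  obtain ⟨r, hr⟩ := exists_isMorseSplitting_negSpace hU hgrad hH (hdet hgrad)
  have hcard : Fintype.card {i // hH.eigenvalues i < 0} ≤ 1 := by
    rw [← finrank_negSpace, ← not_lt]
    exact fun hlt =>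
      hσ (hr.locallyJoinedIn_of_one_lt_rank (Module.one_lt_rank_of_one_lt_finrank hlt))
  obtain ⟨i, hi⟩ : ∃ i, hH.eigenvalues i < 0 := by
    by_contra! hnonneg
    have : IsEmpty {i // hH.eigenvalues i < 0} := ⟨fun i => (hnonneg i).not_gt i.2⟩
    have hbot : negSpace hH = ⊥ := by simp [negSpace]
    exact hσ (hbot ▸ hr).locallyJoinedIn_of_bot
  refine ⟨hgrad, hH, i, hi, fun j hj => ?_⟩
  have hj' : ¬ hH.eigenvalues j < 0 := fun hlt =>
    hj (congrArg Subtype.val (Fintype.card_le_one_iff.1 hcard ⟨j, hlt⟩ ⟨i, hi⟩))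
  exact (not_lt.1 hj').lt_of_ne' (eigenvalues_ne_zero_of_det_ne_zero hH (hdet hgrad) j)

end Hessian

section Isolated

variable {d : ℕ} {U : EuclideanSpace ℝ (Fin d) → ℝ} {m σ : EuclideanSpace ℝ (Fin d)}

theorem eventually_gradient_ne_zero (hU : ContDiff ℝ 2 U) (hdet : (hessian U σ).det ≠ 0) :
    ∀ᶠ x in 𝓝[≠] σ, gradient U x ≠ 0 := by
  have hker : (fderiv ℝ (fderiv ℝ U) σ).ker = ⊥ := by
    refine LinearMap.ker_eq_bot'.2 fun v hv => ?_
    have hvec : Matrix.vecMul v.ofLp (hessian U σ) = 0 := by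
      refine dotProduct_eq_zero _ fun w => ?_
      rw [← Matrix.dotProduct_mulVec, ← fderiv_fderiv_apply v (WithLp.toLp 2 w)]
      exact DFunLike.congr_fun hv _
    exact WithLp.ofLp_injective 2 (Matrix.eq_zero_of_vecMul_eq_zero hdet hvec)
  obtain ⟨K, -, hK⟩ := LinearMap.exists_antilipschitzWith _ hker
  have hfderiv : HasFDerivAt (fderiv ℝ U) (fderiv ℝ (fderiv ℝ U) σ) σ :=
    ((hU.fderiv_right (m := 1) le_rfl).differentiable one_ne_zero σ).hasFDerivAt
  exact (hfderiv.eventually_ne ⟨K, hK⟩).mono fun x hx => mt gradient_eq_zero_iff.1 hx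

theorem gradient_eq_zero_of_isLocalMin (hm : IsLocalMin U m) : gradient U m = 0 :=
  gradient_eq_zero_iff.2 (hm.fderiv_eq_zero)

theorem eventually_lt_of_isLocalMin (hm : IsLocalMin U m)
    (hcrit : ∀ᶠ x in 𝓝[≠] m, gradient U x ≠ 0) : ∀ᶠ x in 𝓝[≠] m, U m < U x := by
  filter_upwards [hcrit, (eventually_eventually_nhds.2 hm).filter_mono nhdsWithin_le_nhds]
    with x hx hmx
  refine hmx.self_of_nhds.lt_of_ne fun heq => hx ?_
  exact gradient_eq_zero_of_isLocalMin (hmx.mono fun y hy => heq ▸ hy)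

theorem finite_gradient_eq_zero_inter_sublevel (hU : ContDiff ℝ 2 U)
    (hcoer : Tendsto U (cocompact _) atTop)
    (hdet : ∀ x, gradient U x = 0 → (hessian U x).det ≠ 0) (c : ℝ) :
    {x | gradient U x = 0 ∧ U x ≤ c}.Finite := by
  by_contra hinf
  have hcompact : IsCompact {x | gradient U x = 0 ∧ U x ≤ c} := by
    refine (isCompact_sublevel hU.continuous hcoer c).inter_left ?_
    simp only [gradient_eq_zero_iff]
    exact isClosed_eq (hU.continuous_fderiv two_ne_zero) continuous_const
  obtain ⟨z, hz, hacc⟩ := exists_nhds_ne_inf_principal_neBot hcompact hinf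
  obtain ⟨x, hx0, hx⟩ := (accPt_iff_frequently_nhdsNE.1 hacc).and_eventually
    (eventually_gradient_ne_zero hU (hdet z hz.1)) |>.exists
  exact hx hx0.1

end Isolated

section CommunicationHeight

variable {d : ℕ} {U : EuclideanSpace ℝ (Fin d) → ℝ} {c : ℝ} {m m' x y : EuclideanSpace ℝ (Fin d)}

theorem bddAbove_range_comp_path (hU : Continuous U) (z : Path x y) :
    BddAbove (range fun t => U (z t)) :=
  (isCompact_range (hU.comp z.continuous)).bddAbove

theorem commHeight_le (hU : Continuous U) (z : Path x y) (hz : ∀ t, U (z t) ≤ c) :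
    commHeight U x y ≤ c := by
  have hbdd : BddBelow (range fun z : Path x y => ⨆ t, U (z t)) :=
    ⟨U x, forall_mem_range.2 fun w => by simpa using le_ciSup (bddAbove_range_comp_path hU w) 0⟩
  exact (ciInf_le hbdd z).trans (ciSup_le hz)

theorem commHeight_lt_iff (hU : Continuous U) :
    commHeight U x y < c ↔ JoinedIn {p | U p < c} x y := by
  have : Nonempty (Path x y) := PathConnectedSpace.joined x y
  refine ⟨fun h => ?_, fun ⟨z, hz⟩ => ?_⟩
  · obtain ⟨z, hz⟩ := exists_lt_of_ciInf_lt h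
    exact ⟨z, fun t => (le_ciSup (bddAbove_range_comp_path hU z) t).trans_lt hz⟩
  · obtain ⟨t, -, ht⟩ := isCompact_univ.exists_isMaxOn univ_nonempty
      (hU.comp z.continuous).continuousOn
    exact (commHeight_le hU z fun s => ht (mem_univ s)).trans_lt (hz t)

theorem right_le_commHeight (hU : Continuous U) : U y ≤ commHeight U x y :=
  le_of_forall_gt fun _ h => ((commHeight_lt_iff hU).1 h).target_mem

theorem isLeast_add_depth (hU : Continuous U) (hfin : ∀ c, {p | IsLocalMin U p ∧ U p ≤ c}.Finite)
    (hother : ∃ m', IsLocalMin U m' ∧ m' ≠ m) :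
    IsLeast (commHeight U m '' {m' | IsLocalMin U m' ∧ m' ≠ m}) (U m + depth U m) := by
  obtain ⟨m₁, hm₁⟩ := hother
  have hfin₁ : {p | (IsLocalMin U p ∧ p ≠ m) ∧ commHeight U m p ≤ commHeight U m m₁}.Finite :=
    (hfin (commHeight U m m₁)).subset fun p hp => ⟨hp.1.1, (right_le_commHeight hU).trans hp.2⟩
  obtain ⟨m₂, hm₂, hmin⟩ := exists_min_image _ (commHeight U m) hfin₁ ⟨m₁, hm₁, le_rfl⟩
  have hleast : IsLeast (commHeight U m '' {m' | IsLocalMin U m' ∧ m' ≠ m})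
      (commHeight U m m₂) := by
    refine ⟨mem_image_of_mem _ hm₂.1, forall_mem_image.2 fun p hp => ?_⟩
    exact (le_total (commHeight U m p) (commHeight U m m₁)).elim (fun h => hmin p ⟨hp, h⟩)
      hm₂.2.trans
  rwa [depth, add_sub_cancel, hleast.csInf_eq]

end CommunicationHeight

section OptimalPath

variable {d : ℕ} {U : EuclideanSpace ℝ (Fin d) → ℝ} {m m' σ : EuclideanSpace ℝ (Fin d)}

theorem IsOptimalPath.not_locallyJoinedIn (hU : Continuous U) {z : Path m m'}
    (hz : IsOptimalPath U z) : ¬ LocallyJoinedIn {x | U x < U (z half)} (z half) := by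
  intro h
  have h0 : half ≠ 0 := fun h => by simpa [half] using congrArg Subtype.val h
  have h1 : half ≠ 1 := fun h => by simpa [half] using congrArg Subtype.val h
  have hlt := (commHeight_lt_iff hU).2 (h.joinedIn_of_path h0 h1 hz.lt_of_ne)
  exact hlt.ne (hz.eq_commHeight.symm.trans hz.eq_depth.symm)

theorem isOptimalPath_of_forall_lt (hU : Continuous U) {z : Path m m'}
    (heq : U (z half) = U m + depth U m) (hlt : ∀ t ≠ half, U (z t) < U (z half))
    (hle : U m + depth U m ≤ commHeight U m m') : IsOptimalPath U z := by
  have hmax : ∀ t, U (z t) ≤ U (z half) := fun t =>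
    (eq_or_ne t half).elim (fun h => h ▸ le_rfl) fun h => (hlt t h).le
  exact ⟨⟨mem_range_self half, forall_mem_range.2 hmax⟩, heq,
    hle.antisymm (heq ▸ commHeight_le hU z hmax), hlt⟩

theorem exists_path_of_mem_closure_pathComponentIn (hU : ContDiff ℝ 2 U)
    (hcoer : Tendsto U (cocompact _) atTop)
    (hdet : gradient U σ = 0 → (hessian U σ).det ≠ 0)
    (hσ : σ ∈ closure (pathComponentIn {x | U x < U σ} m))
    (hσ' : σ ∈ closure ({x | U x < U σ} \ pathComponentIn {x | U x < U σ} m)) :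
    ∃ p, IsLocalMin U p ∧ p ≠ m ∧
      ∃ z : Path m p, z half = σ ∧ ∀ t ≠ half, U (z t) < U σ := by
  have hgrad := gradient_eq_zero_of_not_locallyJoinedIn hU
    (not_locallyJoinedIn_of_mem_closure hσ hσ')
  obtain ⟨r, hr⟩ :=
    exists_isMorseSplitting_negSpace hU hgrad (isHermitian_hessian hU σ) (hdet hgrad)
  have hball := ball_mem_nhds σ hr.radius_pos
  obtain ⟨x, hx, hmx⟩ := mem_closure_iff_nhds.1 hσ _ hball
  obtain ⟨y, hy, hyσ, hmy⟩ := mem_closure_iff_nhds.1 hσ' _ hball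
  obtain ⟨p, hp, hyp⟩ := exists_isLocalMin_joinedIn hU.continuous hcoer hyσ
  refine ⟨p, hp, fun hpm => hmy (hpm ▸ hyp).symm, ?_⟩
  have hmσ : IsAccessibleIn {x | U x < U σ} m σ :=
    .of_joinedIn hmx (hr.isAccessibleIn hx (pathComponentIn_subset (F := {x | U x < U σ}) hmx))
  have hpσ : IsAccessibleIn {x | U x < U σ} p σ := .of_joinedIn hyp.symm (hr.isAccessibleIn hy hyσ)
  exact hmσ.exists_path hpσ

theorem exists_isOptimalPath (hU : ContDiff ℝ 2 U) (hcoer : Tendsto U (cocompact _) atTop)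
    (hdet : ∀ x, gradient U x = 0 → (hessian U x).det ≠ 0) (hm : IsLocalMin U m)
    (hother : ∃ m', IsLocalMin U m' ∧ m' ≠ m) :
    ∃ m', IsLocalMin U m' ∧ m' ≠ m ∧ ∃ z : Path m m', IsOptimalPath U z := by
  have hcont := hU.continuous
  have hfin : ∀ c, {p | IsLocalMin U p ∧ U p ≤ c}.Finite := fun c =>
    (finite_gradient_eq_zero_inter_sublevel hU hcoer hdet c).subset
      fun p hp => ⟨gradient_eq_zero_of_isLocalMin hp.1, hp.2⟩
  obtain ⟨⟨m₁, ⟨hm₁, hne₁⟩, hheight⟩, hleast⟩ := isLeast_add_depth hcont hfin hother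
  obtain ⟨e, he, hnot⟩ := exists_gt_not_joinedIn_of_strict_localMin hcont hcoer
    (eventually_lt_of_isLocalMin hm
      (eventually_gradient_ne_zero hU (hdet m (gradient_eq_zero_of_isLocalMin hm)))) hne₁
  have hmc : U m < U m + depth U m :=
    he.trans_le (hheight ▸ not_lt.1 (mt (commHeight_lt_iff hcont).1 hnot))
  obtain ⟨σ, hσ, hσ'⟩ := exists_mem_closure_pathComponentIn_inter_closure hcont hcoer
    ((hfin _).subset fun p hp => ⟨hp.1, hp.2.le⟩) hmc hm₁
    (fun h => ((commHeight_lt_iff hcont).2 h).ne hheight)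
    fun e he => (commHeight_lt_iff hcont).1 (hheight.trans_lt he)
  have hσc := eq_of_mem_closure_pathComponentIn hcont hσ hσ'
  rw [← hσc] at hσ hσ'
  obtain ⟨p, hp, hpm, z, rfl, hz⟩ :=
    exists_path_of_mem_closure_pathComponentIn hU hcoer (hdet σ) hσ hσ'
  exact ⟨p, hp, hpm, z, isOptimalPath_of_forall_lt hcont hσc hz
    (hleast (mem_image_of_mem _ ⟨hp, hpm⟩))⟩

end OptimalPath

theorem tendsto_cocompact_of_tendsto_div_norm {E : Type*} [NormedAddCommGroup E] [ProperSpace E]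
    {U : E → ℝ} (hU : Tendsto (fun x => U x / ‖x‖) (Bornology.cobounded E) atTop) :
    Tendsto U (cocompact E) atTop := by
  rw [← Metric.cobounded_eq_cocompact]
  refine (hU.atTop_mul_atTop₀ tendsto_norm_cobounded_atTop).congr' ?_
  filter_upwards [Bornology.eventually_ne_cobounded 0] with x hx
  exact div_mul_cancel₀ _ (norm_ne_zero_iff.2 hx)

end MorsePotential

theorem propositionA1_general {d : ℕ} (U : EuclideanSpace ℝ (Fin d) → ℝ) (hU : ContDiff ℝ 2 U)
    (hcoer : Tendsto U (cocompact _) atTop)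
    (hdet : ∀ x, gradient U x = 0 → (MorsePotential.hessian U x).det ≠ 0)
    (m : EuclideanSpace ℝ (Fin d)) (hm : IsLocalMin U m)
    (hother : ∃ m', IsLocalMin U m' ∧ m' ≠ m) :
    (∃ m', IsLocalMin U m' ∧ m' ≠ m ∧ ∃ z : Path m m', MorsePotential.IsOptimalPath U z) ∧
    (∀ m' (z : Path m m'), MorsePotential.IsOptimalPath U z →
      MorsePotential.IsSaddlePoint U (z MorsePotential.half)) :=
  ⟨MorsePotential.exists_isOptimalPath hU hcoer hdet hm hother, fun _ _ hz =>
    MorsePotential.isSaddlePoint_of_not_locallyJoinedIn hU (hdet _)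
      (hz.not_locallyJoinedIn hU.continuous)⟩

theorem propositionA1 {d : ℕ} (U : EuclideanSpace ℝ (Fin d) → ℝ)
    (hU : MorsePotential.IsAdmissible U)
    (m : EuclideanSpace ℝ (Fin d)) (hm : IsLocalMin U m)
    (hother : ∃ m', IsLocalMin U m' ∧ m' ≠ m) :
    (∃ m', IsLocalMin U m' ∧ m' ≠ m ∧
      ∃ z : Path m m', MorsePotential.IsOptimalPath U z) ∧
    (∀ m', IsLocalMin U m' → m' ≠ m →
      ∀ z : Path m m', MorsePotential.IsOptimalPath U z →
        MorsePotential.IsSaddlePoint U (z MorsePotential.half)) := by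
  obtain ⟨hexists, hsaddle⟩ := propositionA1_general U (hU.contDiff.of_le (by norm_num))
    (MorsePotential.tendsto_cocompact_of_tendsto_div_norm hU.superlinear) hU.nondegenerate m hm
    hother
  exact ⟨hexists, fun m' _ _ => hsaddle m'⟩
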